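/- Let $\mathcal H$ be a separable complex Hilbert space and let $S$ be a densely defined closed symmetric operator in $\mathcal H$ with equal infinite deficiency indices, i.e. $\dim\ker(S^*-i)=\dim\ker(S^*+i)=\infty$, and assume that $S$ has a self-adjoint extension in $\mathcal H$ with compact resolvent. Let $\mathcal G$ be a separable infinite-dimensional complex Hilbert space and let $\Xi$ be a self-adjoint operator in $\mathcal G$ with $\mathbb R\cap\rho(\Xi)\neq\emptyset$. Then there exists a self-adjoint extension $A$ of $S$ in $\mathcal H$ such that $$\sigma_{\rm ess}(A)=\sigma_{\rm ess}(\Xi).$$ Here, for a self-adjoint operator $T$, $\sigma_{\rm ess}(T)$ is the set of all points of $\sigma(T)$ that are not isolated points of $\sigma(T)$ which are eigenvalues with finite-dimensional eigenspace. More precisely, let $A_0$ be any self-adjoint extension of $S$ in $\mathcal H$ with compact resolvent. Then $\mathbb R\cap\rho(A_0)\cap\rho(\Xi)\ne\emptyset$, and for every $\mu\in\mathbb R\cap\rho(A_0)\cap\rho(\Xi)$ the following holds. One has the orthogonal sum decomposition $\mathcal H=\ker(S^*-\mu)\oplus\operatorname{ran}(S-\mu)$; there exist unitary operators $U:\mathcal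 G\to\ker(S^*-\mu)$; and for every such $U$ there is a self-adjoint extension $A$ of $S$ in $\mathcal H$ with $\mu\in\rho(A)$, $$(A-\mu)^{-1}=(A_0-\mu)^{-1}+\begin{pmatrix}U(\Xi-\mu)^{-1}U^{-1}&0\\0&0\end{pmatrix}$$ with respect to this decomposition, and $\sigma_{\rm ess}(A)=\sigma_{\rm ess}(\Xi)$. -/

import Mathlib

open scoped Topology

namespace HilbertOp

variable {H : Type*} [NormedAddCommGroup H] [InnerProductSpace ℂ H]
variable {G : Type*} [NormedAddCommGroup G] [InnerProductSpace ℂ G]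

/-- The kernel `ker (T - z)` of an operator `T` with domain in `H`, as a subspace of `H`:
all `x ∈ dom T` with `T x = z x`. -/
def kerSub (T : H →ₗ.[ℂ] H) (z : ℂ) : Submodule ℂ H where
  carrier := {x | ∃ hx : x ∈ T.domain, T ⟨x, hx⟩ = z • x}
  zero_mem' := ⟨T.domain.zero_mem, by
    rw [smul_zero]; exact T.map_zero⟩
  add_mem' := by
    rintro x y ⟨hx, hx'⟩ ⟨hy, hy'⟩
    refine ⟨T.domain.add_mem hx hy, ?_⟩
    rw [smul_add, ← hx', ← hy']
    exact T.map_add ⟨x, hx⟩ ⟨y, hy⟩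
  smul_mem' := by
    rintro c x ⟨hx, hx'⟩
    refine ⟨T.domain.smul_mem c hx, ?_⟩
    rw [smul_comm, ← hx']
    exact T.map_smul c ⟨x, hx⟩

/-- The range `ran (T - z)` of `T - z`, whose domain is `dom T`. -/
def ranSub (T : H →ₗ.[ℂ] H) (z : ℂ) : Submodule ℂ H :=
  LinearMap.range (T.toFun - z • T.domain.subtype)

/-- `R` is a bounded, everywhere defined, two-sided inverse of `T - z : dom T → H`. -/
def IsResolventAt (T : H →ₗ.[ℂ] H) (z : ℂ) (R : H →L[ℂ] H) : Prop :=
  (∀ h : H, ∃ hR : R h ∈ T.domain, T ⟨R h, hR⟩ - z • R h = h) ∧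
    ∀ x : T.domain, R (T x - z • (x : H)) = x

/-- The resolvent set `ρ(T)`. -/
def resolventSet (T : H →ₗ.[ℂ] H) : Set ℂ := {z | ∃ R : H →L[ℂ] H, IsResolventAt T z R}

/-- The spectrum `σ(T) = ℂ \ ρ(T)`. -/
def spec (T : H →ₗ.[ℂ] H) : Set ℂ := (resolventSet T)ᶜ

open scoped Classical in
/-- The resolvent `(T - z)⁻¹`, for `z ∈ ρ(T)` (and `0` for other `z`). -/
noncomputable def resolvent (T : H →ₗ.[ℂ] H) (z : ℂ) : H →L[ℂ] H :=
  if h : ∃ R : H →L[ℂ] H, IsResolventAt T z R then h.choose else 0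

theorem isResolventAt_resolvent {T : H →ₗ.[ℂ] H} {z : ℂ} (hz : z ∈ resolventSet T) :
    IsResolventAt T z (resolvent T z) := by
  have hz' : ∃ R : H →L[ℂ] H, IsResolventAt T z R := hz
  rw [resolvent, dif_pos hz']
  exact hz'.choose_spec

theorem IsResolventAt.eq_resolvent {T : H →ₗ.[ℂ] H} {z : ℂ} {R : H →L[ℂ] H}
    (hR : IsResolventAt T z R) : R = resolvent T z := by
  ext h
  obtain ⟨hx, hh⟩ := hR.1 h
  have := (isResolventAt_resolvent ⟨R, hR⟩).2 ⟨R h, hx⟩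
  rw [hh] at this
  exact this.symm

/-- `T` has compact resolvent: `(T - z)⁻¹` is a compact operator for some `z ∈ ρ(T)`
(equivalently, by the resolvent identity, `ρ(T)` is nonempty and this holds for all `z ∈ ρ(T)`). -/
def HasCompactResolvent (T : H →ₗ.[ℂ] H) : Prop :=
  ∃ z ∈ resolventSet T, IsCompactOperator (resolvent T z)

/-- The discrete spectrum: isolated points of `σ(T)` which are eigenvalues with a
finite dimensional eigenspace. -/
def discSpec (T : H →ₗ.[ℂ] H) : Set ℂ :=
  {z | z ∈ spec T ∧ (∃ N ∈ 𝓝 z, N ∩ spec T = {z}) ∧ kerSub T z ≠ ⊥ ∧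
    FiniteDimensional ℂ (kerSub T z)}

/-- The essential spectrum: the complement of the discrete spectrum in the spectrum. -/
def essSpec (T : H →ₗ.[ℂ] H) : Set ℂ := spec T \ discSpec T

/-- `dim ker (S* - z)` as an element of `ℕ ∪ {∞}`. The deficiency indices of `S` are the values
at `z = i` and `z = -i`. -/
noncomputable def deficiencyIndex [CompleteSpace H] (S : H →ₗ.[ℂ] H) (z : ℂ) : ℕ∞ :=
  Cardinal.toENat (Module.rank ℂ (kerSub S.adjoint z))

/-- `D` is the operator in `H` with block matrix `[B, 0; 0, 0]` with respect to the decomposition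
`H = K ⊕ L`, where the operator `B` in `G` is regarded as an operator in `K` by means of the
unitary `U : G → K`. -/
def IsCornerBlock (K L : Submodule ℂ H) (U : G ≃ₗᵢ[ℂ] K) (B : G →L[ℂ] G) (D : H →L[ℂ] H) : Prop :=
  (∀ k : K, D k = U (B (U.symm k))) ∧ ∀ l ∈ L, D l = 0

end HilbertOp

/-! Everything is read off from bounded resolvents at a real point `μ`. If `R` is the self-adjoint
resolvent of `T` at `μ`, then `z ∉ essSpec T` exactly when `1 - (z - μ) • R` is left invertible
modulo compact operators (`notMem_essSpec_iff`). This criterion is visibly stable under compact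
perturbation of `R` and under adding a zero block, so `R₀ + V C V*`, with `R₀` compact, `C` the
resolvent of `Ξ` and `V` an isometry, has the essential spectrum of `Ξ`
(`essSpec_eq_of_resolvent_eq`).

That sum is a resolvent of an extension of `S`: if `V` maps onto `ker (S* - μ) = ran (S - μ)ᗮ`, the
added block vanishes on `ran (S - μ)`, so the sum still sends `S y - μ y` to `y`. Its range contains
the dense `dom S`; being self-adjoint it is injective, and `μ + (R₀ + V C V*)⁻¹` is the required
`A`.

A common real `μ` exists because the real spectrum of `A₀` is countable, while the real part of
`ρ(Ξ)` is open and nonempty. -/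

namespace HilbertOp

/-! ### Resolvents as inverses of `1 - (z - w) • R` -/

section ResolventAlgebra

variable {H : Type*} [NormedAddCommGroup H] [InnerProductSpace ℂ H]

theorem IsResolventAt.resolvent_identity {T : H →ₗ.[ℂ] H} {w z : ℂ} {R R' : H →L[ℂ] H}
    (hR : IsResolventAt T w R) (hR' : IsResolventAt T z R') :
    R' = R + (z - w) • (R * R') := by
  ext h
  obtain ⟨hx, hh⟩ := hR'.1 h
  have h1 := hR.2 ⟨R' h, hx⟩
  rw [sub_eq_iff_eq_add.mp hh] at h1
  have h2 : h + z • R' h - w • R' h = h + (z - w) • R' h := by rw [sub_smul]; abel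
  simp only [h2, map_add, map_smul] at h1
  simpa using h1.symm

theorem IsResolventAt.isUnit {T : H →ₗ.[ℂ] H} {w z : ℂ} {R R' : H →L[ℂ] H}
    (hR : IsResolventAt T w R) (hR' : IsResolventAt T z R') :
    IsUnit (1 - (z - w) • R) := by
  have h1 := hR.resolvent_identity hR'
  have h2 := hR'.resolvent_identity hR
  refine ⟨⟨1 - (z - w) • R, 1 + (z - w) • R', ?_, ?_⟩, rfl⟩
  · have : (1 - (z - w) • R) * (1 + (z - w) • R')
        = 1 + (z - w) • (R' - (R + (z - w) • (R * R'))) := by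
      simp only [mul_add, sub_mul, one_mul, mul_one, smul_mul_assoc, mul_smul_comm, smul_sub,
        smul_add]
      abel
    rw [this, ← h1]; simp
  · have : (1 + (z - w) • R') * (1 - (z - w) • R)
        = 1 - (z - w) • (R - (R' + (w - z) • (R' * R))) := by
      rw [← neg_sub z w]
      simp only [mul_sub, add_mul, one_mul, mul_one, smul_mul_assoc, mul_smul_comm, smul_sub,
        smul_add, neg_smul, smul_neg]
      abel
    rw [this, ← h2]; simp

/-- The resolvent at `z` is `R (1 - (z - w) R)⁻¹`; the two factors commute. -/
theorem IsResolventAt.of_isUnit {T : H →ₗ.[ℂ] H} {w z : ℂ} {R : H →L[ℂ] H}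
    (hR : IsResolventAt T w R) (hu : IsUnit (1 - (z - w) • R)) : z ∈ resolventSet T := by
  obtain ⟨u, hu⟩ := hu
  set V : H →L[ℂ] H := ((u⁻¹ : (H →L[ℂ] H)ˣ) : H →L[ℂ] H) with hV
  have huV : (1 - (z - w) • R) * V = 1 := by rw [← hu, hV, Units.mul_inv]
  have hVu : V * (1 - (z - w) • R) = 1 := by rw [← hu, hV, Units.inv_mul]
  have hcomm : V * R = R * V := by
    have hc : Commute R (u : H →L[ℂ] H) := by
      rw [hu]
      exact (Commute.one_right R).sub_right ((Commute.refl R).smul_right _)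
    exact (hc.units_inv_right).eq.symm
  refine ⟨R * V, fun h => ?_, fun x => ?_⟩
  · obtain ⟨hx, hh⟩ := hR.1 (V h)
    refine ⟨hx, ?_⟩
    have h1 := congrArg (fun L : H →L[ℂ] H => L h) huV
    simp only [mul_apply_eq_comp, sub_apply,
      one_apply_eq_self, smul_apply] at h1 ⊢
    rw [sub_eq_iff_eq_add.mp hh]
    conv_rhs => rw [← h1]
    rw [sub_smul]; abel
  · have h1 := hR.2 x
    have h2 : T x - z • (x : H) = (T x - w • (x : H)) - (z - w) • (x : H) := by
      rw [sub_smul]; abel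
    have h3 := congrArg (fun L : H →L[ℂ] H => L (x : H)) hVu
    rw [← hcomm, h2]
    simp only [mul_apply_eq_comp, sub_apply,
      one_apply_eq_self, smul_apply, map_sub, map_smul] at h3 ⊢
    rw [← map_smul V w, ← map_sub V, ← map_smul R w, ← map_sub R, h1]
    exact h3

theorem IsResolventAt.mem_resolventSet_iff {T : H →ₗ.[ℂ] H} {w : ℂ} {R : H →L[ℂ] H}
    (hR : IsResolventAt T w R) (z : ℂ) : z ∈ resolventSet T ↔ IsUnit (1 - (z - w) • R) :=
  ⟨fun ⟨_, hR'⟩ => hR.isUnit hR', hR.of_isUnit⟩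

theorem IsResolventAt.mem_kerSub_iff {T : H →ₗ.[ℂ] H} {w : ℂ} {R : H →L[ℂ] H}
    (hR : IsResolventAt T w R) (z : ℂ) (x : H) :
    x ∈ kerSub T z ↔ (1 - (z - w) • R) x = 0 := by
  simp only [sub_apply, one_apply_eq_self,
    smul_apply, sub_eq_zero]
  constructor
  · rintro ⟨hx, h⟩
    have := hR.2 ⟨x, hx⟩
    rw [h, ← sub_smul, map_smul] at this
    exact this.symm
  · intro h
    obtain ⟨hx, hh⟩ := hR.1 ((z - w) • x)
    have h' : R ((z - w) • x) = x := by rw [map_smul, ← h]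
    simp only [h'] at hx hh
    refine ⟨hx, ?_⟩
    rw [sub_eq_iff_eq_add.mp hh, ← add_smul, sub_add_cancel]

theorem isOpen_resolventSet [CompleteSpace H] (T : H →ₗ.[ℂ] H) : IsOpen (resolventSet T) := by
  rw [isOpen_iff_mem_nhds]
  rintro w ⟨R, hR⟩
  have hc : Continuous fun z : ℂ => (1 - (z - w) • R : H →L[ℂ] H) := by fun_prop
  have : IsOpen {z : ℂ | IsUnit (1 - (z - w) • R : H →L[ℂ] H)} := Units.isOpen.preimage hc
  refine Filter.mem_of_superset (this.mem_nhds (by simp)) fun z hz => hR.of_isUnit hz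

end ResolventAlgebra

/-! ### Bounds from below and invertibility -/

section BoundedBelow

variable {H : Type*} [NormedAddCommGroup H] [InnerProductSpace ℂ H]

/-- Otherwise there are unit vectors `y n` with `A (y n) → 0`. Compactness of `B * A - 1` makes a
subsequence converge, and its limit is a unit vector in the kernel of `A`. -/
theorem exists_bound_of_left_inverse_mod_compact {A B : H →L[ℂ] H}
    (hA : Function.Injective A) (hK : IsCompactOperator (B * A - 1 : H →L[ℂ] H)) :
    ∃ c : ℝ, 0 < c ∧ ∀ x, c * ‖x‖ ≤ ‖A x‖ := by
  by_contra! hcon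
  have hex : ∀ n : ℕ, ∃ y : H, ‖y‖ = 1 ∧ ‖A y‖ < 1 / ((n : ℝ) + 1) := by
    intro n
    obtain ⟨x, hx⟩ := hcon (1 / ((n : ℝ) + 1)) (by positivity)
    have hx0 : x ≠ 0 := by rintro rfl; simp at hx
    have hxn : 0 < ‖x‖ := norm_pos_iff.mpr hx0
    refine ⟨((‖x‖⁻¹ : ℝ) : ℂ) • x, ?_, ?_⟩
    · rw [norm_smul]; simp [hxn.ne']
    · rw [map_smul, norm_smul, Complex.norm_real, norm_inv, norm_norm, inv_mul_lt_iff₀ hxn,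
        mul_comm]
      exact hx
  choose y hy1 hyA using hex
  have hA0 : Filter.Tendsto (fun n => A (y n)) Filter.atTop (𝓝 0) :=
    squeeze_zero_norm (fun n => (hyA n).le) tendsto_one_div_add_atTop_nhds_zero_nat
  have hcpt := hK.isCompact_closure_image_closedBall (𝕜₁ := ℂ) 1
  obtain ⟨a, -, φ, hφ, hlim⟩ := hcpt.tendsto_subseq (x := fun n => (B * A - 1 : H →L[ℂ] H) (y n))
    (fun n => subset_closure ⟨y n, by simp [hy1], rfl⟩)
  have hBA : Filter.Tendsto (fun n => B (A (y (φ n)))) Filter.atTop (𝓝 0) := by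
    have := (B.continuous.tendsto 0).comp (hA0.comp hφ.tendsto_atTop)
    rwa [map_zero] at this
  have hy : Filter.Tendsto (fun n => y (φ n)) Filter.atTop (𝓝 (-a)) := by
    have := hBA.sub hlim
    simpa using this
  have hAa : A (-a) = 0 :=
    tendsto_nhds_unique ((A.continuous.tendsto _).comp hy) (hA0.comp hφ.tendsto_atTop)
  have ha0 : -a = 0 := hA (by rw [hAa, map_zero])
  have hn : ‖-a‖ = 1 := tendsto_nhds_unique hy.norm (by simp [hy1])
  rw [ha0] at hn
  simp at hn

/-- The bound gives injectivity and closed range; self-adjointness identifies the orthogonal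
complement of the range with the kernel. -/
theorem isUnit_of_isSelfAdjoint_of_bound [CompleteSpace H] {A : H →L[ℂ] H}
    (hA : IsSelfAdjoint A) {c : ℝ} (hc : 0 < c) (h : ∀ x, c * ‖x‖ ≤ ‖A x‖) : IsUnit A := by
  have hinj : Function.Injective A := by
    rw [injective_iff_map_eq_zero]
    intro x hx
    have := h x
    rw [hx, norm_zero] at this
    exact norm_le_zero_iff.mp (nonpos_of_mul_nonpos_right this hc)
  have hanti : AntilipschitzWith (Real.toNNReal c⁻¹) A := by
    refine AddMonoidHomClass.antilipschitz_of_bound A fun x => ?_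
    rw [Real.coe_toNNReal _ (by positivity), inv_mul_eq_div, le_div_iff₀ hc, mul_comm]
    exact h x
  have hcl : IsClosed (LinearMap.range (A : H →ₗ[ℂ] H) : Set H) :=
    hanti.isClosed_range A.uniformContinuous
  have hbot : (LinearMap.range (A : H →ₗ[ℂ] H))ᗮ = ⊥ := by
    rw [Submodule.eq_bot_iff]
    intro x hx
    apply hinj
    rw [map_zero]
    refine ext_inner_left ℂ fun v => ?_
    have h1 := ContinuousLinearMap.isSelfAdjoint_iff_isSymmetric.mp hA v x
    simp only [ContinuousLinearMap.coe_coe] at h1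
    rw [← h1, inner_zero_right]
    exact hx _ ⟨v, rfl⟩
  have hsurj : LinearMap.range (A : H →ₗ[ℂ] H) = ⊤ := by
    have := hcl.completeSpace_coe
    rwa [Submodule.orthogonal_eq_bot_iff] at hbot
  rw [ContinuousLinearMap.isUnit_iff_bijective]
  exact ⟨hinj, LinearMap.range_eq_top.mp hsurj⟩

end BoundedBelow
end HilbertOp

namespace HilbertOp

/-! ### Essential spectrum as failure of left invertibility modulo compacts -/

section EssentialSpectrum

/-- Since `f` commutes with `p`, it splits: it is `d` on the range of `p` and agrees with `f + p` on
the range of `1 - p`. -/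
theorem isUnit_of_isUnit_add_idempotent {A : Type*} [Ring A] [Algebra ℂ A] {f p : A} {d : ℂ}
    (hd : d ≠ 0) (hp : p * p = p) (hfp : f * p = d • p) (hpf : p * f = d • p)
    (hu : IsUnit (f + p)) : IsUnit f := by
  obtain ⟨u, hu⟩ := hu
  have hcp : Commute p (u : A) := by
    rw [hu, commute_iff_eq, mul_add, add_mul, hfp, hpf]
  have hcf : Commute f (u : A) := by
    rw [hu, commute_iff_eq, mul_add, add_mul, hfp, hpf]
  have hf : f = u - p := by rw [hu, add_sub_cancel_right]
  set v : A := ((u⁻¹ : Aˣ) : A) with hv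
  have hpv : Commute p v := hcp.units_inv_right
  have hfv : Commute f v := hcf.units_inv_right
  have huv : (u : A) * v = 1 := by rw [hv, Units.mul_inv]
  have hX : f * (v * (1 - p) + d⁻¹ • p) = 1 := by
    have h1 : f * (v * (1 - p)) = 1 - p := by
      have h3 : p * (v * (1 - p)) = 0 := by
        rw [← mul_assoc, hpv.eq, mul_assoc, mul_sub, mul_one, hp, sub_self, mul_zero]
      calc f * (v * (1 - p)) = u * (v * (1 - p)) - p * (v * (1 - p)) := by
            rw [← sub_mul, ← hf]
        _ = 1 - p := by rw [h3, sub_zero, ← mul_assoc, huv, one_mul]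
    rw [mul_add, h1, mul_smul_comm, hfp, smul_smul, inv_mul_cancel₀ hd, one_smul, sub_add_cancel]
  have hcX : Commute f (v * (1 - p) + d⁻¹ • p) := by
    have hfp' : Commute f p := by rw [commute_iff_eq, hfp, hpf]
    exact (hfv.mul_right ((Commute.one_right f).sub_right hfp')).add_right (hfp'.smul_right _)
  exact ⟨⟨f, _, hX, hcX.eq ▸ hX⟩, rfl⟩

theorem isUnit_one_sub_smul_iff {A : Type*} [Ring A] [Algebra ℂ A] {c : ℂ} (hc : c ≠ 0) (a : A) :
    IsUnit (1 - c • a) ↔ c⁻¹ ∉ spectrum ℂ a := by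
  have : (1 - c • a) = Units.mk0 c hc • (algebraMap ℂ A c⁻¹ - a) := by
    rw [Units.smul_mk0, smul_sub, Algebra.algebraMap_eq_smul_one, smul_smul, mul_inv_cancel₀ hc,
      one_smul]
  rw [spectrum.notMem_iff, this, isUnit_smul_iff]

variable {H : Type*} [NormedAddCommGroup H] [InnerProductSpace ℂ H]

theorem _root_.IsCompactOperator.of_apply_eq {M N : Type*} [Zero M]
    [TopologicalSpace M] [TopologicalSpace N] {f g : M → N} (hf : IsCompactOperator f)
    (h : ∀ x, g x = f x) : IsCompactOperator g :=
  (funext h : g = f) ▸ hf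

/-- On `ker A` the compact operator `B * A - 1` is minus the identity. -/
theorem finiteDimensional_ker_of_left_inverse_mod_compact {A B : H →L[ℂ] H}
    (hK : IsCompactOperator (B * A - 1 : H →L[ℂ] H)) :
    FiniteDimensional ℂ (LinearMap.ker (A : H →ₗ[ℂ] H)) := by
  have hval : ∀ x ∈ LinearMap.ker (A : H →ₗ[ℂ] H), (B * A - 1 : H →L[ℂ] H) x = -x := by
    intro x hx
    have hx' : A x = 0 := hx
    simp [hx']
  have hres := IsCompactOperator.restrict (f := ((B * A - 1 : H →L[ℂ] H) : H →ₗ[ℂ] H)) hK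
    (V := LinearMap.ker (A : H →ₗ[ℂ] H))
    (fun x hx => by
      rw [ContinuousLinearMap.coe_coe, hval x hx]
      exact Submodule.neg_mem _ hx) A.isClosed_ker
  refine FiniteDimensional.of_isCompactOperator_id (𝕜 := ℂ) ?_
  refine hres.neg.of_apply_eq fun x => Subtype.ext ?_
  simp only [id, Pi.neg_apply, LinearMap.restrict_apply, ContinuousLinearMap.coe_coe,
    hval x x.2, Submodule.coe_neg, neg_neg]

theorem isCompactOperator_of_range_le {A : H →L[ℂ] H} (E : Submodule ℂ H)
    [FiniteDimensional ℂ E] (h : ∀ x, A x ∈ E) : IsCompactOperator A :=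
  have : ProperSpace E := FiniteDimensional.proper ℂ E
  have h1 : IsCompactOperator (A.codRestrict E h) :=
    isCompactOperator_of_locallyCompactSpace_dom _
  h1.clm_comp E.subtypeL

variable [CompleteSpace H]

/-- Adding to `F = 1 - (z - w) R` the projection `P` onto its finite-dimensional kernel gives an
invertible operator. Invertibility persists for `z'` near `z`, and since `P` reduces `R`, it can be
removed again when `z' ≠ z`; hence `z` is isolated. -/
theorem notMem_essSpec_of_left_inverse_mod_compact {T : H →ₗ.[ℂ] H} {w : ℝ} {R : H →L[ℂ] H}
    (hR : IsResolventAt T w R) (hsa : IsSelfAdjoint R) {z : ℂ} {B : H →L[ℂ] H}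
    (hB : IsCompactOperator (B * (1 - (z - w) • R) - 1 : H →L[ℂ] H)) : z ∉ essSpec T := by
  intro hz
  obtain ⟨hzs, hzd⟩ := hz
  have hnu : ¬ IsUnit (1 - (z - w) • R) := fun h => hzs ((hR.mem_resolventSet_iff z).mpr h)
  have hc : z - w ≠ 0 := by
    intro h
    rw [h] at hnu
    simp at hnu
  -- A spectral point of the self-adjoint `R` is real; hence so is `z - w`, and `F` is self-adjoint.
  have hreal : (starRingEnd ℂ) (z - w) = z - w := by
    have h1 : (z - w)⁻¹ ∈ spectrum ℂ R := by
      by_contra h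
      exact hnu ((isUnit_one_sub_smul_iff hc R).mpr h)
    have h2 := hsa.mem_spectrum_eq_re h1
    rw [← inv_inj, ← map_inv₀, h2]
    exact Complex.conj_ofReal _
  set F : H →L[ℂ] H := 1 - (z - w) • R with hF
  have hFsa : IsSelfAdjoint F :=
    (IsSelfAdjoint.one _).sub (IsSelfAdjoint.smul hreal hsa)
  set E := LinearMap.ker (F : H →ₗ[ℂ] H) with hE
  have : FiniteDimensional ℂ E := finiteDimensional_ker_of_left_inverse_mod_compact hB
  set P := E.starProjection with hP
  have hPsa : IsSelfAdjoint P := isSelfAdjoint_starProjection E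
  have hPP : P * P = P := E.isIdempotentElem_starProjection
  have hFP : F * P = 0 := by
    ext x
    exact E.starProjection_apply_mem x
  have hPF : P * F = 0 := by
    have := congrArg star hFP
    rwa [star_mul, hFsa.star_eq, hPsa.star_eq, star_zero] at this
  have hu : IsUnit (F + P) := by
    have hinj : Function.Injective (F + P) := by
      rw [injective_iff_map_eq_zero]
      intro x hx
      have h1 : P x = 0 := by
        have := congrArg P hx
        rw [map_zero, ← mul_apply_eq_comp, mul_add, hPF, hPP, zero_add] at this
        exact this
      have h2 : F x = 0 := by
        rw [add_apply, h1, add_zero] at hx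
        exact hx
      rw [← h1]
      exact (E.starProjection_eq_self_iff.mpr h2).symm
    have hcpt : IsCompactOperator (B * (F + P) - 1 : H →L[ℂ] H) := by
      have h1 : IsCompactOperator P :=
        isCompactOperator_of_range_le E fun x => E.starProjection_apply_mem x
      have h2 := hB.add (h1.clm_comp B)
      refine h2.of_apply_eq fun x => ?_
      simp [mul_add]
      abel
    obtain ⟨c, hc0, hbd⟩ := exists_bound_of_left_inverse_mod_compact hinj hcpt
    exact isUnit_of_isSelfAdjoint_of_bound (hFsa.add hPsa) hc0 hbd
  have hker : kerSub T z = E := by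
    ext x
    rw [hR.mem_kerSub_iff]
    rfl
  refine hzd ⟨hzs, ?_, ?_, ?_⟩
  · have hcont : Continuous fun z' : ℂ => (1 - (z' - w) • R + P : H →L[ℂ] H) := by fun_prop
    have hopen : IsOpen {z' : ℂ | IsUnit (1 - (z' - w) • R + P : H →L[ℂ] H)} :=
      Units.isOpen.preimage hcont
    refine ⟨_, hopen.mem_nhds hu, ?_⟩
    refine Set.Subset.antisymm ?_ (Set.singleton_subset_iff.mpr ⟨hu, hzs⟩)
    rintro z' ⟨hz'u, hz's⟩
    by_contra hne
    refine hz's ((hR.mem_resolventSet_iff z').mpr ?_)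
    -- This is the scalar by which `1 - (z' - w) • R` acts on the range of `P`.
    have hd : 1 - (z' - w) * (z - w)⁻¹ ≠ 0 := by
      intro h
      apply hne
      rw [sub_eq_zero, eq_mul_inv_iff_mul_eq₀ hc, one_mul, sub_left_inj] at h
      exact h.symm
    have hRP : R * P = (z - w)⁻¹ • P := by
      rw [hF, sub_mul, one_mul, smul_mul_assoc, sub_eq_zero] at hFP
      conv_rhs => rw [hFP]
      rw [smul_smul, inv_mul_cancel₀ hc, one_smul]
    have hPR : P * R = (z - w)⁻¹ • P := by
      rw [hF, mul_sub, mul_one, mul_smul_comm, sub_eq_zero] at hPF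
      conv_rhs => rw [hPF]
      rw [smul_smul, inv_mul_cancel₀ hc, one_smul]
    refine isUnit_of_isUnit_add_idempotent hd hPP ?_ ?_ hz'u
    · rw [sub_mul, one_mul, smul_mul_assoc, hRP, smul_smul, sub_smul, one_smul]
    · rw [mul_sub, mul_one, mul_smul_comm, hPR, smul_smul, sub_smul, one_smul]
  · rw [hker]
    intro hbot
    have hP0 : P = 0 := by
      ext x
      have := E.starProjection_apply_mem x
      exact (Submodule.mem_bot ℂ).mp (hbot.le this)
    rw [hP0, add_zero] at hu
    exact hnu hu
  · rw [hker]
    infer_instance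

/-- Continuous functional calculus: as `c⁻¹` is isolated, both its indicator `f` and the function
`g`, equal to `(1 - cζ)⁻¹` away from `c⁻¹` and `0` there, are continuous on the spectrum. Then
`g(R)(1 - cR) = 1 - f(R)`, and `f(R)` maps into the finite-dimensional kernel. -/
theorem exists_left_inverse_mod_compact_of_isolated {R : H →L[ℂ] H} (hsa : IsSelfAdjoint R)
    {c : ℂ} (hc : c ≠ 0) (hiso : ∀ᶠ ζ in 𝓝 c⁻¹, ζ ∈ spectrum ℂ R → ζ = c⁻¹)
    (hfin : FiniteDimensional ℂ (LinearMap.ker ((1 - c • R : H →L[ℂ] H) : H →ₗ[ℂ] H))) :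
    ∃ B : H →L[ℂ] H, IsCompactOperator (B * (1 - c • R) - 1 : H →L[ℂ] H) := by
  classical
  have hn : IsStarNormal R := hsa.isStarNormal
  have hcontOn : ∀ (a : ℂ) (k : ℂ → ℂ), (∀ ζ, ζ ≠ c⁻¹ → ContinuousAt k ζ) →
      ContinuousOn (fun ζ => if ζ = c⁻¹ then a else k ζ) (spectrum ℂ R) := by
    intro a k hk ζ hζ
    by_cases h : ζ = c⁻¹
    · subst h
      refine (continuousWithinAt_const (b := a)).congr_of_eventuallyEq ?_ (by simp)
      filter_upwards [mem_nhdsWithin_of_mem_nhds hiso, self_mem_nhdsWithin] with ζ h1 h2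
      simp [h1 h2]
    · refine ((hk ζ h).congr ?_).continuousWithinAt
      filter_upwards [isOpen_ne.mem_nhds h] with ξ hξ
      simp [show ξ ≠ c⁻¹ from hξ]
  set f : ℂ → ℂ := fun ζ => if ζ = c⁻¹ then 1 else 0 with hf
  set g : ℂ → ℂ := fun ζ => if ζ = c⁻¹ then 0 else (1 - c * ζ)⁻¹ with hg
  have hne : ∀ ζ, ζ ≠ c⁻¹ → 1 - c * ζ ≠ 0 := by
    intro ζ hζ h
    apply hζ
    rw [sub_eq_zero] at h
    exact eq_inv_of_mul_eq_one_right h.symm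
  have hfc : ContinuousOn f (spectrum ℂ R) := hcontOn 1 _ fun ζ _ => continuousAt_const
  have hgc : ContinuousOn g (spectrum ℂ R) := hcontOn 0 _ fun ζ hζ =>
    ContinuousAt.inv₀ (by fun_prop) (hne ζ hζ)
  have hlin : cfc (fun ζ : ℂ => 1 - c * ζ) R = 1 - c • R := by
    rw [cfc_sub (a := R) (fun _ => 1) (fun ζ => c * ζ), cfc_const_one ℂ R,
      cfc_const_mul_id c R]
  have hlc : ContinuousOn (fun ζ : ℂ => 1 - c * ζ) (spectrum ℂ R) := by fun_prop
  have hFE : (1 - c • R) * cfc f R = 0 := by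
    rw [← hlin, ← cfc_mul _ _ R hlc hfc, ← cfc_zero ℂ R]
    congr 1
    ext ζ
    by_cases h : ζ = c⁻¹ <;> simp [hf, h, hc]
  have hBF : cfc g R * (1 - c • R) = 1 - cfc f R := by
    rw [← hlin, ← cfc_mul _ _ R hgc hlc, ← cfc_const_one ℂ R, ← cfc_sub _ _ R (by fun_prop) hfc]
    congr 1
    ext ζ
    by_cases h : ζ = c⁻¹
    · simp [hf, hg, h]
    · simp [hf, hg, h, hne ζ h]
  refine ⟨cfc g R, ?_⟩
  have hE : IsCompactOperator (cfc f R : H →L[ℂ] H) :=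
    isCompactOperator_of_range_le (LinearMap.ker ((1 - c • R : H →L[ℂ] H) : H →ₗ[ℂ] H)) fun x =>
      (congrArg (fun L : H →L[ℂ] H => L x) hFE : (1 - c • R : H →L[ℂ] H) (cfc f R x) = 0)
  rw [hBF]
  refine hE.neg.of_apply_eq fun x => ?_
  simp

theorem notMem_essSpec_iff {T : H →ₗ.[ℂ] H} {w : ℝ} {R : H →L[ℂ] H}
    (hR : IsResolventAt T w R) (hsa : IsSelfAdjoint R) (z : ℂ) :
    z ∉ essSpec T ↔
      ∃ B : H →L[ℂ] H, IsCompactOperator (B * (1 - (z - w) • R) - 1 : H →L[ℂ] H) := by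
  refine ⟨fun hz => ?_, fun ⟨B, hB⟩ => notMem_essSpec_of_left_inverse_mod_compact hR hsa hB⟩
  by_cases hzs : z ∈ resolventSet T
  · obtain ⟨u, hu⟩ := (hR.mem_resolventSet_iff z).mp hzs
    refine ⟨((u⁻¹ : (H →L[ℂ] H)ˣ) : H →L[ℂ] H), ?_⟩
    rw [← hu, Units.inv_mul, sub_self]
    exact isCompactOperator_zero
  have hzd : z ∈ discSpec T := by
    by_contra h
    exact hz ⟨hzs, h⟩
  obtain ⟨-, ⟨N, hN, hNs⟩, -, hfin⟩ := hzd
  have hc : z - w ≠ 0 := by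
    intro h
    rw [sub_eq_zero] at h
    exact hzs (h ▸ ⟨R, hR⟩)
  refine exists_left_inverse_mod_compact_of_isolated hsa hc ?_ ?_
  -- The map `ζ ↦ w + ζ⁻¹` carries nonzero spectral points of `R` to spectral points of `T`, so
  -- isolation pulls back along it.
  · have hcont : ContinuousAt (fun ζ : ℂ => w + ζ⁻¹) (z - w)⁻¹ :=
      continuousAt_const.add (continuousAt_inv₀ (inv_ne_zero hc))
    have hN' : N ∈ 𝓝 ((fun ζ : ℂ => w + ζ⁻¹) (z - w)⁻¹) := by
      simpa using hN
    filter_upwards [hcont hN', isOpen_ne.mem_nhds (inv_ne_zero hc)] with ζ hζN hζ0 hζs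
    have hmem : (w : ℂ) + ζ⁻¹ ∈ N ∩ spec T := by
      refine ⟨hζN, fun h => ?_⟩
      rw [hR.mem_resolventSet_iff, add_sub_cancel_left,
        isUnit_one_sub_smul_iff (inv_ne_zero hζ0), inv_inv] at h
      exact h hζs
    rw [hNs, Set.mem_singleton_iff] at hmem
    rw [← hmem, add_sub_cancel_left, inv_inv]
  · have : kerSub T z = LinearMap.ker ((1 - (z - w) • R : H →L[ℂ] H) : H →ₗ[ℂ] H) := by
      ext x
      rw [hR.mem_kerSub_iff]
      rfl
    rwa [← this]

end EssentialSpectrum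
end HilbertOp

namespace HilbertOp

/-! ### Self-adjoint operators and their resolvents -/

section SelfAdjoint

variable {H : Type*} [NormedAddCommGroup H] [InnerProductSpace ℂ H] [CompleteSpace H]

theorem isFormalAdjoint_self {A : H →ₗ.[ℂ] H} (hA : IsSelfAdjoint A) : A.IsFormalAdjoint A := by
  have := A.adjoint_isFormalAdjoint hA.dense_domain
  rwa [LinearPMap.isSelfAdjoint_def.mp hA] at this

theorem IsResolventAt.isSelfAdjoint {A : H →ₗ.[ℂ] H} (hA : IsSelfAdjoint A) {w : ℝ}
    {R : H →L[ℂ] H} (hR : IsResolventAt A w R) : IsSelfAdjoint R := by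
  rw [ContinuousLinearMap.isSelfAdjoint_iff_isSymmetric]
  intro h k
  simp only [ContinuousLinearMap.coe_coe]
  obtain ⟨hx, hh⟩ := hR.1 h
  obtain ⟨hy, hk⟩ := hR.1 k
  have h1 := isFormalAdjoint_self hA ⟨R h, hx⟩ ⟨R k, hy⟩
  calc inner ℂ (R h) k = inner ℂ (R h) (A ⟨R k, hy⟩ - (w : ℂ) • R k) := by rw [hk]
    _ = inner ℂ (A ⟨R h, hx⟩ - (w : ℂ) • R h) (R k) := by
      rw [inner_sub_right, inner_sub_left, h1, inner_smul_right, inner_smul_left,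
        Complex.conj_ofReal]
    _ = inner ℂ h (R k) := by rw [hh]

/-- The operator `w + R⁻¹` with domain `ran R`, for an injective bounded operator `R`. -/
noncomputable def ofResolvent (w : ℂ) (R : H →L[ℂ] H) (hR : Function.Injective R) :
    H →ₗ.[ℂ] H where
  domain := LinearMap.range (R : H →ₗ[ℂ] H)
  toFun := (LinearEquiv.ofInjective (R : H →ₗ[ℂ] H) hR).symm.toLinearMap
    + w • (LinearMap.range (R : H →ₗ[ℂ] H)).subtype

omit [CompleteSpace H] in
theorem mem_domain_ofResolvent (w : ℂ) {R : H →L[ℂ] H} (hR : Function.Injective R) (h : H) :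
    R h ∈ (ofResolvent w R hR).domain := ⟨h, rfl⟩

omit [CompleteSpace H] in
theorem exists_eq_of_domain_ofResolvent (w : ℂ) {R : H →L[ℂ] H} (hR : Function.Injective R)
    (x : (ofResolvent w R hR).domain) : ∃ h, x = ⟨R h, mem_domain_ofResolvent w hR h⟩ := by
  obtain ⟨_, h, rfl⟩ := x
  exact ⟨h, rfl⟩

omit [CompleteSpace H] in
theorem ofResolvent_apply (w : ℂ) {R : H →L[ℂ] H} (hR : Function.Injective R) (h : H) :
    ofResolvent w R hR ⟨R h, mem_domain_ofResolvent w hR h⟩ = h + w • R h := by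
  have h1 : (LinearEquiv.ofInjective (R : H →ₗ[ℂ] H) hR).symm ⟨R h, h, rfl⟩ = h := by
    rw [LinearEquiv.symm_apply_eq]
    rfl
  exact congrArg (fun y : H => y + w • R h) h1

omit [CompleteSpace H] in
theorem isResolventAt_ofResolvent (w : ℂ) {R : H →L[ℂ] H} (hR : Function.Injective R) :
    IsResolventAt (ofResolvent w R hR) w R := by
  refine ⟨fun h => ⟨mem_domain_ofResolvent w hR h, ?_⟩, fun x => ?_⟩
  · rw [ofResolvent_apply w hR h, add_sub_cancel_right]
  · obtain ⟨h, rfl⟩ := exists_eq_of_domain_ofResolvent w hR x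
    rw [ofResolvent_apply w hR h, add_sub_cancel_right]

theorem isSelfAdjoint_ofResolvent (w : ℝ) {R : H →L[ℂ] H} (hR : Function.Injective R)
    (hsa : IsSelfAdjoint R) (hd : Dense (Set.range R)) :
    IsSelfAdjoint (ofResolvent (w : ℂ) R hR) := by
  have hsym : ∀ x y, inner ℂ (R x) y = inner ℂ x (R y) :=
    ContinuousLinearMap.isSelfAdjoint_iff_isSymmetric.mp hsa
  have hdom : Dense ((ofResolvent (w : ℂ) R hR).domain : Set H) := hd
  have hform : (ofResolvent (w : ℂ) R hR).IsFormalAdjoint (ofResolvent (w : ℂ) R hR) := by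
    intro x y
    obtain ⟨h, rfl⟩ := exists_eq_of_domain_ofResolvent _ hR x
    obtain ⟨k, rfl⟩ := exists_eq_of_domain_ofResolvent _ hR y
    rw [ofResolvent_apply _ hR h, ofResolvent_apply _ hR k, inner_add_left, inner_add_right,
      inner_smul_left, inner_smul_right, Complex.conj_ofReal]
    exact congrArg (· + _) (hsym h k).symm
  rw [LinearPMap.isSelfAdjoint_def]
  refine (LinearPMap.eq_of_le_of_domain_eq (hform.le_adjoint hdom) ?_).symm
  refine le_antisymm (hform.le_adjoint hdom).1 fun x hx => ?_
  -- For `x` in the adjoint domain, testing against `R h` shows `x = R (T* x - w x)`, where `T` is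
  -- the operator `w + R⁻¹`.
  refine ⟨(ofResolvent (w : ℂ) R hR).adjoint ⟨x, hx⟩ - (w : ℂ) • x, ?_⟩
  refine ext_inner_right ℂ fun h => ?_
  have h1 := (ofResolvent (w : ℂ) R hR).adjoint_isFormalAdjoint hdom ⟨x, hx⟩
    ⟨R h, mem_domain_ofResolvent _ hR h⟩
  rw [ofResolvent_apply _ hR h, inner_add_right, inner_smul_right] at h1
  rw [ContinuousLinearMap.coe_coe, hsym, inner_sub_left, inner_smul_left, Complex.conj_ofReal, h1]
  simp

end SelfAdjoint

/-! ### Range and defect space of the symmetric operator -/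

section Symmetric

variable {H : Type*} [NormedAddCommGroup H] [InnerProductSpace ℂ H]

theorem mem_ranSub_iff {S : H →ₗ.[ℂ] H} {z : ℂ} {y : H} :
    y ∈ ranSub S z ↔ ∃ x : S.domain, S x - z • (x : H) = y := Iff.rfl

theorem IsResolventAt.apply_of_le {S A : H →ₗ.[ℂ] H} (h : S ≤ A) {w : ℂ} {R : H →L[ℂ] H}
    (hR : IsResolventAt A w R) (x : S.domain) : R (S x - w • (x : H)) = x := by
  rw [h.2 (y := ⟨x, h.1 x.2⟩) rfl]
  exact hR.2 ⟨x, h.1 x.2⟩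

/-- The range is the preimage of the closed graph of `S` under `y ↦ (R y, y + w R y)`. -/
theorem isClosed_ranSub {S A : H →ₗ.[ℂ] H} (hS : S.IsClosed) (h : S ≤ A) {w : ℂ}
    {R : H →L[ℂ] H} (hR : IsResolventAt A w R) : IsClosed (ranSub S w : Set H) := by
  have hc : Continuous fun y : H => (R y, y + w • R y) := by fun_prop
  have : (ranSub S w : Set H) = (fun y : H => (R y, y + w • R y)) ⁻¹' (S.graph : Set (H × H)) := by
    ext y
    simp only [SetLike.mem_coe, Set.mem_preimage, LinearPMap.mem_graph_iff, mem_ranSub_iff]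
    constructor
    · rintro ⟨x, rfl⟩
      exact ⟨x, (hR.apply_of_le h x).symm, by rw [hR.apply_of_le h x, sub_add_cancel]⟩
    · rintro ⟨x, hx, hy⟩
      exact ⟨x, by rw [hy, hx, add_sub_cancel_right]⟩
  rw [this]
  exact IsClosed.preimage hc hS

variable [CompleteSpace H]

theorem kerSub_adjoint {S : H →ₗ.[ℂ] H} (hS : Dense (S.domain : Set H)) (z : ℂ) :
    kerSub S.adjoint z = (ranSub S (starRingEnd ℂ z))ᗮ := by
  ext x
  rw [Submodule.mem_orthogonal']
  constructor
  · rintro ⟨hx, hxz⟩ _ ⟨y, rfl⟩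
    have := S.adjoint_isFormalAdjoint hS ⟨x, hx⟩ y
    rw [hxz, inner_smul_left] at this
    change inner ℂ x (S y - starRingEnd ℂ z • (y : H)) = 0
    rw [inner_sub_right, inner_smul_right, ← this, sub_self]
  · intro h
    have h1 : ∀ y : S.domain, inner ℂ (z • x) (y : H) = inner ℂ x (S y) := by
      intro y
      have := h _ (mem_ranSub_iff.mpr ⟨y, rfl⟩)
      rw [inner_sub_right, inner_smul_right, sub_eq_zero] at this
      rw [inner_smul_left, this]
    have hx : x ∈ S.adjoint.domain := LinearPMap.mem_adjoint_domain_of_exists _ ⟨_, h1⟩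
    exact ⟨hx, LinearPMap.adjoint_apply_eq hS _ h1⟩

/-- The operator `1 - (i - w) R` is invertible, as `R` has real spectrum, and it maps `ker (S* - i)`
into `ker (S* - w)`. Infinite dimension is thus carried over to `w`. -/
theorem not_finiteDimensional_kerSub_adjoint {S A : H →ₗ.[ℂ] H} (hS : Dense (S.domain : Set H))
    (h : S ≤ A) {w : ℝ} {R : H →L[ℂ] H} (hR : IsResolventAt A w R) (hsa : IsSelfAdjoint R)
    (hdef : deficiencyIndex S Complex.I = ⊤) :
    ¬ FiniteDimensional ℂ (kerSub S.adjoint (w : ℂ)) := by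
  have hsym : ∀ x y, inner ℂ (R x) y = inner ℂ x (R y) :=
    ContinuousLinearMap.isSelfAdjoint_iff_isSymmetric.mp hsa
  intro hfin
  have hwI : (Complex.I - w) ≠ 0 := by
    intro h0
    simpa using congrArg Complex.im h0
  have hu : IsUnit (1 - (Complex.I - w) • R) := by
    rw [isUnit_one_sub_smul_iff hwI]
    intro hmem
    have h1 := hsa.mem_spectrum_eq_re hmem
    generalize (Complex.I - (w : ℂ))⁻¹.re = r at h1
    rw [inv_eq_iff_eq_inv, ← Complex.ofReal_inv] at h1
    simpa using congrArg Complex.im h1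
  have hinj := ((ContinuousLinearMap.isUnit_iff_bijective).mp hu).1
  have hmaps : ∀ x ∈ kerSub S.adjoint Complex.I,
      (1 - (Complex.I - w) • R : H →L[ℂ] H) x ∈ kerSub S.adjoint (w : ℂ) := by
    intro x hx
    rw [kerSub_adjoint hS, Submodule.mem_orthogonal] at hx ⊢
    rintro _ ⟨y, rfl⟩
    rw [Complex.conj_ofReal]
    change inner ℂ (S y - (w : ℂ) • (y : H)) _ = 0
    have h1 := hx _ (mem_ranSub_iff.mpr ⟨y, rfl⟩)
    have h2 := hsym (S y - (w : ℂ) • (y : H)) x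
    rw [hR.apply_of_le h y] at h2
    rw [inner_sub_left, inner_smul_left, Complex.conj_conj, sub_eq_zero] at h1
    rw [sub_apply, smul_apply, one_apply_eq_self, inner_sub_right, inner_smul_right, ← h2,
      inner_sub_left, inner_smul_left, Complex.conj_ofReal, h1]
    ring
  let L : kerSub S.adjoint Complex.I →ₗ[ℂ] kerSub S.adjoint (w : ℂ) :=
    ((1 - (Complex.I - w) • R : H →L[ℂ] H) : H →ₗ[ℂ] H).restrict hmaps
  have hL : Function.Injective L := fun x y hxy =>
    Subtype.ext (hinj (congrArg Subtype.val hxy))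
  have : FiniteDimensional ℂ (kerSub S.adjoint Complex.I) := Module.Finite.of_injective L hL
  rw [deficiencyIndex, Cardinal.toENat_eq_top] at hdef
  exact absurd (Module.rank_lt_aleph0 ℂ (kerSub S.adjoint Complex.I)) (not_lt.mpr hdef)

end Symmetric
end HilbertOp

namespace HilbertOp

/-! ### Separability and the choice of a common real resolvent point -/

section Separable

variable {H : Type*} [NormedAddCommGroup H] [InnerProductSpace ℂ H]

/-- Orthonormal vectors are `√2` apart, so the balls of radius `1/2` around them are disjoint. -/
theorem _root_.Orthonormal.countable_of_separableSpace [TopologicalSpace.SeparableSpace H]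
    {ι : Type*} {v : ι → H} (hv : Orthonormal ℂ v) : Countable ι := by
  refine Pairwise.countable_of_isOpen_disjoint (s := fun i => Metric.ball (v i) (1 / 2)) ?_
    (fun _ => Metric.isOpen_ball) (fun i => ⟨v i, by simp⟩)
  intro i j hij
  refine Metric.ball_disjoint_ball ?_
  have h1 : ‖v i - v j‖ ^ 2 = 2 := by
    rw [norm_sub_sq (𝕜 := ℂ), hv.1, hv.1, hv.2 hij]
    norm_num
  rw [dist_eq_norm]
  nlinarith [norm_nonneg (v i - v j)]

theorem exists_hilbertBasis_nat [CompleteSpace H] [TopologicalSpace.SeparableSpace H]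
    (hH : ¬ FiniteDimensional ℂ H) : Nonempty (HilbertBasis ℕ ℂ H) := by
  obtain ⟨s, b, -⟩ := exists_hilbertBasis ℂ H
  have hc : Countable s := b.orthonormal.countable_of_separableSpace
  have hi : Infinite s := by
    rw [← not_finite_iff_infinite]
    intro hf
    have := Fintype.ofFinite s
    exact hH b.toOrthonormalBasis.toBasis.finiteDimensional_of_finite
  obtain ⟨e⟩ := nonempty_equiv_of_countable (α := ℕ) (β := s)
  refine ⟨HilbertBasis.mk (b.orthonormal.comp e e.injective) ?_⟩
  rw [e.surjective.range_comp, b.dense_span]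

theorem nonempty_linearIsometryEquiv_of_separableSpace [CompleteSpace H]
    [TopologicalSpace.SeparableSpace H] (hH : ¬ FiniteDimensional ℂ H)
    {G : Type*} [NormedAddCommGroup G] [InnerProductSpace ℂ G] [CompleteSpace G]
    [TopologicalSpace.SeparableSpace G] (hG : ¬ FiniteDimensional ℂ G) :
    Nonempty (G ≃ₗᵢ[ℂ] H) := by
  obtain ⟨b⟩ := exists_hilbertBasis_nat hH
  obtain ⟨b'⟩ := exists_hilbertBasis_nat hG
  exact ⟨b'.repr.trans b.repr.symm⟩

variable [CompleteSpace H]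

/-- By the Fredholm alternative for the compact resolvent each such `μ` is an eigenvalue; unit
eigenvectors for distinct `μ` are orthonormal, hence countably many. -/
theorem countable_real_notMem_resolventSet [TopologicalSpace.SeparableSpace H]
    {A : H →ₗ.[ℂ] H} (hA : IsSelfAdjoint A) (hc : HasCompactResolvent A) :
    {μ : ℝ | (μ : ℂ) ∉ resolventSet A}.Countable := by
  obtain ⟨z, hz, hcpt⟩ := hc
  have hR := isResolventAt_resolvent hz
  set R := resolvent A z
  have hex : ∀ μ : {μ : ℝ | (μ : ℂ) ∉ resolventSet A},
      ∃ x : H, ‖x‖ = 1 ∧ x ∈ kerSub A ((μ : ℝ) : ℂ) := by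
    rintro ⟨μ, hμ⟩
    have hμz : (μ : ℂ) - z ≠ 0 := by
      intro h
      rw [sub_eq_zero] at h
      exact hμ (h ▸ hz)
    have hμ' : (μ : ℂ) ∉ resolventSet A := hμ
    rw [hR.mem_resolventSet_iff, isUnit_one_sub_smul_iff hμz, not_not] at hμ'
    rw [← hcpt.hasEigenvalue_iff_mem_spectrum (inv_ne_zero hμz)] at hμ'
    obtain ⟨x, hx⟩ := hμ'.exists_hasEigenvector
    have hx0 : ‖x‖ ≠ 0 := norm_ne_zero_iff.mpr hx.2
    refine ⟨((‖x‖⁻¹ : ℝ) : ℂ) • x, ?_, Submodule.smul_mem _ _ ?_⟩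
    · rw [norm_smul]; simp [hx0]
    · have h1 : R x = ((μ : ℂ) - z)⁻¹ • x := hx.apply_eq_smul
      rw [hR.mem_kerSub_iff]
      simp [h1, smul_smul, hμz]
  choose x hx1 hxk using hex
  have hon : Orthonormal ℂ x := by
    refine ⟨hx1, fun μ ν hμν => ?_⟩
    obtain ⟨hm, hm'⟩ := hxk μ
    obtain ⟨hn, hn'⟩ := hxk ν
    have h1 := isFormalAdjoint_self hA ⟨x μ, hm⟩ ⟨x ν, hn⟩
    rw [hm', hn', inner_smul_left, inner_smul_right, Complex.conj_ofReal] at h1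
    refine (mul_eq_mul_right_iff.mp h1).resolve_left fun h => hμν ?_
    exact Subtype.ext (Complex.ofReal_injective h)
  exact Set.countable_coe_iff.mp hon.countable_of_separableSpace

theorem exists_real_mem_resolventSet_inter [TopologicalSpace.SeparableSpace H]
    {G : Type*} [NormedAddCommGroup G] [InnerProductSpace ℂ G] [CompleteSpace G]
    {A : H →ₗ.[ℂ] H} (hA : IsSelfAdjoint A) (hc : HasCompactResolvent A)
    {Ξ : G →ₗ.[ℂ] G} (hΞ : ∃ μ : ℝ, (μ : ℂ) ∈ resolventSet Ξ) :
    ∃ μ : ℝ, (μ : ℂ) ∈ resolventSet A ∧ (μ : ℂ) ∈ resolventSet Ξ := by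
  have hd := (countable_real_notMem_resolventSet hA hc).dense_compl ℝ
  have ho : IsOpen {μ : ℝ | (μ : ℂ) ∈ resolventSet Ξ} :=
    (isOpen_resolventSet Ξ).preimage Complex.continuous_ofReal
  obtain ⟨μ, h1, h2⟩ := hd.inter_open_nonempty _ ho hΞ
  exact ⟨μ, not_not.mp h2, h1⟩

omit [CompleteSpace H] in
theorem IsResolventAt.isCompactOperator {A : H →ₗ.[ℂ] H} {w z : ℂ} {R R' : H →L[ℂ] H}
    (hR : IsResolventAt A w R) (hc : IsCompactOperator R) (hR' : IsResolventAt A z R') :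
    IsCompactOperator R' := by
  rw [hR.resolvent_identity hR']
  exact hc.add ((hc.comp_clm R').smul (z - w))

end Separable
end HilbertOp

namespace HilbertOp

/-! ### Compact perturbations, corner blocks and the extension -/

section Perturbation

variable {H : Type*} [NormedAddCommGroup H] [InnerProductSpace ℂ H]
variable {G : Type*} [NormedAddCommGroup G] [InnerProductSpace ℂ G]

theorem exists_left_inverse_mod_compact_add {A K : H →L[ℂ] H} (hK : IsCompactOperator K)
    (h : ∃ B : H →L[ℂ] H, IsCompactOperator (B * A - 1 : H →L[ℂ] H)) :
    ∃ B : H →L[ℂ] H, IsCompactOperator (B * (A + K) - 1 : H →L[ℂ] H) := by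
  obtain ⟨B, hB⟩ := h
  refine ⟨B, (hB.add (hK.clm_comp B)).of_apply_eq fun x => ?_⟩
  simp [mul_add]
  abel

theorem exists_left_inverse_mod_compact_conj_iff {V : G →L[ℂ] H} {W : H →L[ℂ] G}
    (hWV : ∀ g, W (V g) = g) (C : G →L[ℂ] G) (c : ℂ) :
    (∃ B : H →L[ℂ] H, IsCompactOperator (B * (1 - c • (V ∘L C ∘L W)) - 1 : H →L[ℂ] H)) ↔
      ∃ B : G →L[ℂ] G, IsCompactOperator (B * (1 - c • C) - 1 : G →L[ℂ] G) := by
  constructor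
  · rintro ⟨B, hB⟩
    refine ⟨W ∘L B ∘L V, ((hB.comp_clm V).clm_comp W).of_apply_eq fun g => ?_⟩
    simp [hWV]
  · rintro ⟨B, hB⟩
    -- The inverse modulo compacts is `B` on the range of `V` and the identity on `ker W`, where `V
    -- C W` vanishes. The error is exactly `V (B (1 - c C) - 1) W`.
    refine ⟨V ∘L B ∘L W + (1 - V ∘L W), ((hB.comp_clm W).clm_comp V).of_apply_eq fun x => ?_⟩
    simp [hWV]
    abel

variable [CompleteSpace H] [CompleteSpace G]

theorem essSpec_eq_of_resolvent_eq {A : H →ₗ.[ℂ] H} {Ξ : G →ₗ.[ℂ] G} {w : ℝ}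
    {R K : H →L[ℂ] H} {C : G →L[ℂ] G} {V : G →L[ℂ] H} {W : H →L[ℂ] G}
    (hA : IsResolventAt A w R) (hR : IsSelfAdjoint R) (hΞ : IsResolventAt Ξ w C)
    (hC : IsSelfAdjoint C) (hWV : ∀ g, W (V g) = g) (hK : IsCompactOperator K)
    (h : R = K + V ∘L C ∘L W) : essSpec A = essSpec Ξ := by
  ext z
  rw [← not_iff_not, notMem_essSpec_iff hA hR, notMem_essSpec_iff hΞ hC,
    ← exists_left_inverse_mod_compact_conj_iff hWV]
  have hK' : IsCompactOperator ((z - w) • K : H →L[ℂ] H) := hK.smul (z - w)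
  have e : 1 - (z - w) • (V ∘L C ∘L W) = 1 - (z - w) • R + (z - w) • K := by
    rw [h, smul_add]; abel
  have e' : 1 - (z - w) • R = 1 - (z - w) • (V ∘L C ∘L W) + -((z - w) • K) := by
    rw [h, smul_add]; abel
  constructor
  · intro hB
    rw [e]
    exact exists_left_inverse_mod_compact_add hK' hB
  · intro hB
    rw [e']
    exact exists_left_inverse_mod_compact_add hK'.neg hB

theorem exists_isSelfAdjoint_extension_cornerBlock {S A₀ : H →ₗ.[ℂ] H} {Ξ : G →ₗ.[ℂ] G}
    (hS : Dense (S.domain : Set H)) (hA₀ : IsSelfAdjoint A₀) (hSA₀ : S ≤ A₀)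
    (hc : HasCompactResolvent A₀) (hΞ : IsSelfAdjoint Ξ) {μ : ℝ}
    (hμ : (μ : ℂ) ∈ resolventSet A₀) (hμΞ : (μ : ℂ) ∈ resolventSet Ξ)
    (hperp : kerSub S.adjoint μ ⟂ ranSub S μ) (U : G ≃ₗᵢ[ℂ] kerSub S.adjoint μ) :
    ∃ (A : H →ₗ.[ℂ] H) (D : H →L[ℂ] H), IsSelfAdjoint A ∧ S ≤ A ∧
      IsCornerBlock (kerSub S.adjoint μ) (ranSub S μ) U (resolvent Ξ μ) D ∧
      (μ : ℂ) ∈ resolventSet A ∧ resolvent A μ = resolvent A₀ μ + D ∧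
      essSpec A = essSpec Ξ := by
  have hR₀ := isResolventAt_resolvent hμ
  have hC := isResolventAt_resolvent hμΞ
  have hRsa := hR₀.isSelfAdjoint hA₀
  have hCsa := hC.isSelfAdjoint hΞ
  obtain ⟨z, hz, hcz⟩ := hc
  have hRc := (isResolventAt_resolvent hz).isCompactOperator hcz hR₀
  set R₀ := resolvent A₀ (μ : ℂ)
  set C := resolvent Ξ (μ : ℂ)
  set V : G →L[ℂ] H :=
    ((kerSub S.adjoint (μ : ℂ)).subtypeₗᵢ.comp U.toLinearIsometry).toContinuousLinearMap with hV
  have hVapp : ∀ g, V g = U g := fun _ => rfl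
  -- `V` is an isometry, so its adjoint is a left inverse; this adjoint acts as `U⁻¹` on the defect
  -- space and kills `ran (S - μ)`.
  have hWV : ∀ g, V.adjoint (V g) = g := by
    intro g
    refine ext_inner_right ℂ fun g' => ?_
    rw [ContinuousLinearMap.adjoint_inner_left]
    exact LinearIsometry.inner_map_map _ g g'
  set D : H →L[ℂ] H := V ∘L C ∘L V.adjoint with hD
  have hDsa : IsSelfAdjoint D := hCsa.conj_adjoint V
  have hDran : ∀ l ∈ ranSub S μ, D l = 0 := by
    intro l hl
    have : V.adjoint l = 0 := by
      refine ext_inner_right ℂ fun g => ?_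
      rw [ContinuousLinearMap.adjoint_inner_left, inner_zero_left]
      exact hperp (U g).2 l hl
    simp [hD, this]
  have hSR : ∀ y : S.domain, (R₀ + D) (S y - (μ : ℂ) • (y : H)) = y := by
    intro y
    rw [add_apply, hR₀.apply_of_le hSA₀ y, hDran _ (mem_ranSub_iff.mpr ⟨y, rfl⟩), add_zero]
  have hsa : IsSelfAdjoint (R₀ + D) := hRsa.add hDsa
  -- The kernel of a self-adjoint operator is orthogonal to its range, which contains the dense `dom
  -- S` by `hSR`.
  have hinj : Function.Injective (R₀ + D) := by
    rw [injective_iff_map_eq_zero]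
    intro x hx
    refine hS.eq_zero_of_inner_left ℂ fun y hy => ?_
    have h1 := ContinuousLinearMap.isSelfAdjoint_iff_isSymmetric.mp hsa x
      (S ⟨y, hy⟩ - (μ : ℂ) • y)
    rw [ContinuousLinearMap.coe_coe, hx, hSR ⟨y, hy⟩, inner_zero_left] at h1
    exact h1.symm
  have hdense : Dense (Set.range (R₀ + D)) :=
    hS.mono fun y hy => ⟨_, hSR ⟨y, hy⟩⟩
  have hres := isResolventAt_ofResolvent (μ : ℂ) hinj
  refine ⟨ofResolvent μ (R₀ + D) hinj, D, isSelfAdjoint_ofResolvent μ hinj hsa hdense, ?_,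
    ⟨fun k => ?_, hDran⟩, ⟨_, hres⟩, hres.eq_resolvent.symm,
    essSpec_eq_of_resolvent_eq hres hsa hC hCsa hWV hRc rfl⟩
  · refine ⟨fun y hy => ⟨_, hSR ⟨y, hy⟩⟩, fun x y hxy => ?_⟩
    obtain ⟨h, rfl⟩ := exists_eq_of_domain_ofResolvent _ hinj y
    have hxh : (x : H) = (R₀ + D) h := hxy
    rw [ofResolvent_apply]
    have h2 : S x - (μ : ℂ) • (x : H) = h := hinj (by rw [hSR, hxh])
    rw [← h2, hSR, sub_add_cancel]
  · have : V.adjoint (k : H) = U.symm k := by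
      rw [← hWV (U.symm k), hVapp, U.apply_symm_apply]
    change V (C (V.adjoint k)) = _
    rw [this, hVapp]

end Perturbation
end HilbertOp

/-! ### The main theorem -/

theorem mainTheorem2
    {H : Type*} [NormedAddCommGroup H] [InnerProductSpace ℂ H] [CompleteSpace H]
    [TopologicalSpace.SeparableSpace H]
    {G : Type*} [NormedAddCommGroup G] [InnerProductSpace ℂ G] [CompleteSpace G]
    [TopologicalSpace.SeparableSpace G] (hG : ¬ FiniteDimensional ℂ G)
    (S : H →ₗ.[ℂ] H) (hSdense : Dense (S.domain : Set H)) (hSclosed : S.IsClosed)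
    (hSsymm : S.IsFormalAdjoint S)
    (hSdef : HilbertOp.deficiencyIndex S Complex.I = ⊤)
    (hSdef' : HilbertOp.deficiencyIndex S (-Complex.I) = ⊤)
    (hScompact : ∃ A₀ : H →ₗ.[ℂ] H, IsSelfAdjoint A₀ ∧ S ≤ A₀ ∧ HilbertOp.HasCompactResolvent A₀)
    (Ξ : G →ₗ.[ℂ] G) (hΞ : IsSelfAdjoint Ξ)
    (hΞres : ∃ μ : ℝ, (μ : ℂ) ∈ HilbertOp.resolventSet Ξ) :
    (∃ A : H →ₗ.[ℂ] H, IsSelfAdjoint A ∧ S ≤ A ∧ HilbertOp.essSpec A = HilbertOp.essSpec Ξ) ∧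
    ∀ A₀ : H →ₗ.[ℂ] H, IsSelfAdjoint A₀ → S ≤ A₀ → HilbertOp.HasCompactResolvent A₀ →
      (∃ μ : ℝ, (μ : ℂ) ∈ HilbertOp.resolventSet A₀ ∧ (μ : ℂ) ∈ HilbertOp.resolventSet Ξ) ∧
      ∀ μ : ℝ, (μ : ℂ) ∈ HilbertOp.resolventSet A₀ → (μ : ℂ) ∈ HilbertOp.resolventSet Ξ →
        IsCompl (HilbertOp.kerSub S.adjoint μ) (HilbertOp.ranSub S μ) ∧
        HilbertOp.kerSub S.adjoint μ ⟂ HilbertOp.ranSub S μ ∧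
        Nonempty (G ≃ₗᵢ[ℂ] HilbertOp.kerSub S.adjoint μ) ∧
        ∀ U : G ≃ₗᵢ[ℂ] HilbertOp.kerSub S.adjoint μ,
          ∃ (A : H →ₗ.[ℂ] H) (D : H →L[ℂ] H),
            IsSelfAdjoint A ∧ S ≤ A ∧
            HilbertOp.IsCornerBlock (HilbertOp.kerSub S.adjoint μ) (HilbertOp.ranSub S μ) U
              (HilbertOp.resolvent Ξ μ) D ∧
            (μ : ℂ) ∈ HilbertOp.resolventSet A ∧
            HilbertOp.resolvent A μ = HilbertOp.resolvent A₀ μ + D ∧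
            HilbertOp.essSpec A = HilbertOp.essSpec Ξ := by
  have key : ∀ A₀ : H →ₗ.[ℂ] H, IsSelfAdjoint A₀ → S ≤ A₀ →
      ∀ μ : ℝ, (μ : ℂ) ∈ HilbertOp.resolventSet A₀ →
        IsCompl (HilbertOp.kerSub S.adjoint μ) (HilbertOp.ranSub S μ) ∧
        HilbertOp.kerSub S.adjoint μ ⟂ HilbertOp.ranSub S μ ∧
        Nonempty (G ≃ₗᵢ[ℂ] HilbertOp.kerSub S.adjoint μ) := by
    intro A₀ hA₀ hSA₀ μ hμ
    have hR := HilbertOp.isResolventAt_resolvent hμ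
    have hclosed := HilbertOp.isClosed_ranSub hSclosed hSA₀ hR
    have hker := HilbertOp.kerSub_adjoint hSdense (μ : ℂ)
    rw [Complex.conj_ofReal] at hker
    have hinf := HilbertOp.not_finiteDimensional_kerSub_adjoint hSdense hSA₀ hR
      (hR.isSelfAdjoint hA₀) hSdef
    have hcomp : CompleteSpace (HilbertOp.ranSub S (μ : ℂ)) := hclosed.completeSpace_coe
    rw [hker] at hinf ⊢
    exact ⟨(Submodule.isCompl_orthogonal _).symm,
      (Submodule.isOrtho_orthogonal_right _).symm,
      HilbertOp.nonempty_linearIsometryEquiv_of_separableSpace hinf hG⟩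
  have main : ∀ A₀ : H →ₗ.[ℂ] H, IsSelfAdjoint A₀ → HilbertOp.HasCompactResolvent A₀ →
      ∃ μ : ℝ, (μ : ℂ) ∈ HilbertOp.resolventSet A₀ ∧ (μ : ℂ) ∈ HilbertOp.resolventSet Ξ :=
    fun A₀ hA₀ hc => HilbertOp.exists_real_mem_resolventSet_inter hA₀ hc hΞres
  refine ⟨?_, fun A₀ hA₀ hSA₀ hc => ⟨main A₀ hA₀ hc, fun μ hμ hμΞ => ?_⟩⟩
  · obtain ⟨A₀, hA₀, hSA₀, hc⟩ := hScompact
    obtain ⟨μ, hμ, hμΞ⟩ := main A₀ hA₀ hc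
    obtain ⟨-, hperp, ⟨U⟩⟩ := key A₀ hA₀ hSA₀ μ hμ
    obtain ⟨A, -, hA, hSA, -, -, -, hess⟩ :=
      HilbertOp.exists_isSelfAdjoint_extension_cornerBlock hSdense hA₀ hSA₀ hc hΞ hμ hμΞ hperp U
    exact ⟨A, hA, hSA, hess⟩
  · obtain ⟨h1, h2, h3⟩ := key A₀ hA₀ hSA₀ μ hμ
    exact ⟨h1, h2, h3, fun U =>
      HilbertOp.exists_isSelfAdjoint_extension_cornerBlock hSdense hA₀ hSA₀ hc hΞ hμ hμΞ h2 U⟩
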